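/- Theorem 4.1 (th:quasipower). Let $\ell,m\ge 1$, let $\xi,\eta\in[0,\infty)^m$ and let $A_1,\dots,A_\ell,B\in[0,\infty)^{m\times m}$ be non-zero matrices. Let $\Sigma=\{a_1,\dots,a_\ell,b\}$, let $\mu:\Sigma^*\to[0,\infty)^{m\times m}$ be the monoid morphism with $\mu(a_i)=A_i$ and $\mu(b)=B$, and assume that for every sufficiently large $n$ there is a word $w\in\Sigma^n$ with $\xi'\mu(w)\eta>0$. For every $n$ with $\sum_{x\in\Sigma^n}\xi'\mu(x)\eta>0$ (hence for all large $n$), choose $w\in\Sigma^n$ at random with probability $\xi'\mu(w)\eta\,/\sum_{x\in\Sigma^n}\xi'\mu(x)\eta$, let ${\bf Y}_n=(|w|_{a_1},\dots,|w|_{a_\ell})$ be the vector of the numbers of occurrences of $a_1,\dots,a_\ell$ in $w$, and let $\Psi_n({\bf t})=\mathbb{E}(e^{{\bf t}\cdot{\bf Y}_n})$ for ${\bf t}\in\mathbb{R}^\ell$. Assume that $M=A_1+\cdots+A_\ell+B$ is primitive, i.e. some power $M^k$, $k\ge1$, has only strictly positive entries. Then $M$ and all the matrices $M({\bf t})=A_1e^{t_1}+\cdots+A_\ell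 e^{t_\ell}+B$, ${\bf t}\in\mathbb{R}^\ell$, have a Perron–Frobenius eigenvalue, i.e. a positive real eigenvalue whose modulus is strictly larger than that of every other complex eigenvalue. Denote it by $\lambda$ for $M$ and by $y({\bf t})$ for $M({\bf t})$. The function $y$ is analytic on $\mathbb{R}^\ell$, and there is an analytic, strictly positive function $r:\mathbb{R}^\ell\to\mathbb{R}$ with $r({\bf 0})=1$ such that for every ${\bf t}\in\mathbb{R}^\ell$ there is $\varepsilon_{\bf t}\in(0,1)$ with $$\Psi_n({\bf t})=r({\bf t})\left(\frac{y({\bf t})}{\lambda}\right)^n\bigl(1+O(\varepsilon_{\bf t}^n)\bigr)\qquad(n\to\infty),$$ where the constant in the $O$-term may depend on ${\bf t}$. -/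

import Mathlib

/-- The alphabet `{a_1, …, a_ℓ, b}`: `some i` is the letter `a_i` and `none` is the letter `b`. -/
abbrev Letter (ℓ : ℕ) : Type := Option (Fin ℓ)

/-- The morphism from words to matrices generated by `a_i ↦ A i` and `b ↦ B`. -/
noncomputable def wordMatrix {ℓ m : ℕ} (A : Fin ℓ → Matrix (Fin m) (Fin m) ℝ)
    (B : Matrix (Fin m) (Fin m) ℝ) :
    FreeMonoid (Letter ℓ) →* Matrix (Fin m) (Fin m) ℝ :=
  FreeMonoid.lift fun x : Letter ℓ => x.elim B A

/-- A word of length `n`, given letter by letter, as an element of the free monoid. -/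
def toWord {ℓ n : ℕ} (w : Fin n → Letter ℓ) : FreeMonoid (Letter ℓ) :=
  FreeMonoid.ofList (List.ofFn w)

/-- A linear representation with `m` states over the alphabet `{a_1, …, a_ℓ, b}`:
entrywise non-negative vectors `ξ`, `η` and non-negative, non-zero matrices `A_1, …, A_ℓ, B`
such that, for every large `n`, some word `w` of length `n` has positive weight
`ξᵀ μ(w) η`, where `μ` is the morphism generated by the matrices. -/
structure LinearRepresentation (ℓ m : ℕ) where
  ξ : Fin m → ℝ
  η : Fin m → ℝ
  A : Fin ℓ → Matrix (Fin m) (Fin m) ℝ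
  B : Matrix (Fin m) (Fin m) ℝ
  ξ_nonneg : ∀ j, 0 ≤ ξ j
  η_nonneg : ∀ j, 0 ≤ η j
  A_nonneg : ∀ i j k, 0 ≤ A i j k
  B_nonneg : ∀ j k, 0 ≤ B j k
  A_ne_zero : ∀ i, A i ≠ 0
  B_ne_zero : B ≠ 0
  exists_pos : ∀ᶠ n in Filter.atTop, ∃ w : Fin n → Letter ℓ,
    0 < ξ ⬝ᵥ (Matrix.mulVec (wordMatrix A B (toWord w)) η)

namespace LinearRepresentation

variable {ℓ m : ℕ} (R : LinearRepresentation ℓ m)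

/-- The rational formal series: the weight `(r, w) = ξᵀ μ(w) η` of a word. -/
noncomputable def series (w : FreeMonoid (Letter ℓ)) : ℝ :=
  R.ξ ⬝ᵥ (Matrix.mulVec (wordMatrix R.A R.B w) R.η)

/-- The total weight of the words of length `n`. -/
noncomputable def totalWeight (n : ℕ) : ℝ :=
  ∑ w : Fin n → Letter ℓ, R.series (toWord w)

/-- The probability of a word of length `n`, proportional to its weight
(meaningful when the total weight at length `n` is positive). -/
noncomputable def wordProb {n : ℕ} (w : Fin n → Letter ℓ) : ℝ :=
  R.series (toWord w) / R.totalWeight n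

/-- When the total weight is positive, the word probabilities sum to `1`. -/
theorem sum_wordProb {n : ℕ} (h : 0 < R.totalWeight n) :
    ∑ w : Fin n → Letter ℓ, R.wordProb w = 1 := by
  unfold wordProb
  rw [← Finset.sum_div]
  exact div_self h.ne'

/-- The random vector `Y_n = (|w|_{a_1}, …, |w|_{a_ℓ})` of numbers of occurrences. -/
def symbolCount {n : ℕ} (w : Fin n → Letter ℓ) (i : Fin ℓ) : ℕ :=
  (toWord w).toList.count (some i)

/-- The moment generating function `Ψ_n(t) = 𝔼[exp(t · Y_n)]`, the expectation being taken
over the words of length `n` with the probability `wordProb`. -/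
noncomputable def momentGen (n : ℕ) (t : Fin ℓ → ℝ) : ℝ :=
  ∑ w : Fin n → Letter ℓ, R.wordProb w * Real.exp (∑ i, t i * (symbolCount w i : ℝ))

/-- The total weight matrix `M = A_1 + ⋯ + A_ℓ + B`. -/
def totalMatrix : Matrix (Fin m) (Fin m) ℝ :=
  (∑ i, R.A i) + R.B

/-- The matrix `M(t) = A_1 e^{t_1} + ⋯ + A_ℓ e^{t_ℓ} + B`. -/
noncomputable def tiltedMatrix (t : Fin ℓ → ℝ) : Matrix (Fin m) (Fin m) ℝ :=
  (∑ i, Real.exp (t i) • R.A i) + R.B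

end LinearRepresentation

/-- `c` is the Perron–Frobenius eigenvalue of the real matrix `T`: a positive real eigenvalue
which is the unique (complex) eigenvalue of largest modulus. -/
structure IsPerronFrobeniusEigenvalue {m : ℕ} (T : Matrix (Fin m) (Fin m) ℝ) (c : ℝ) :
    Prop where
  pos : 0 < c
  hasEigenvalue : Module.End.HasEigenvalue (Matrix.toLin' (T.map Complex.ofReal)) (c : ℂ)
  norm_lt : ∀ z : ℂ, Module.End.HasEigenvalue (Matrix.toLin' (T.map Complex.ofReal)) z →
    z ≠ (c : ℂ) → ‖z‖ < c

/-- A matrix has at most one Perron–Frobenius eigenvalue. -/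
theorem IsPerronFrobeniusEigenvalue.unique {m : ℕ} {T : Matrix (Fin m) (Fin m) ℝ} {c d : ℝ}
    (hc : IsPerronFrobeniusEigenvalue T c) (hd : IsPerronFrobeniusEigenvalue T d) : c = d := by
  by_contra hne
  have h1 := hc.norm_lt d hd.hasEigenvalue (fun h => hne (Complex.ofReal_injective h).symm)
  have h2 := hd.norm_lt c hc.hasEigenvalue (fun h => hne (Complex.ofReal_injective h))
  rw [Complex.norm_real, Real.norm_of_nonneg hd.pos.le] at h1
  rw [Complex.norm_real, Real.norm_of_nonneg hc.pos.le] at h2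
  linarith

/-! Since `wordMatrix` and the exponential weight are both multiplicative over letters, summing over
words of length n gives ξᵀ M(t)^n η, so Ψ_n(t) = ξᵀ M(t)^n η / ξᵀ M(0)^n η (`momentGen_eq`). Each
M(t) dominates a positive multiple of M, hence is primitive. With right and left Perron vectors v, u
and eigenvalue y, Perron–Frobenius theory gives M(t)^n = y^n v uᵀ/(u·v) + O((ρy)^n) with ρ < 1
(`exists_abs_pow_sub_le`). The numerator therefore grows like C(t) y(t)^n with C = (ξ·v)(u·η)/(u·v)
> 0, and r(t) = C(t)/C(0).

Analyticity of y, v and u comes from the implicit function theorem applied to Tv = cv, ∑ v = 1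
(`analyticAt_perron`); simplicity of the Perron eigenvalue makes this system nondegenerate. -/

namespace Matrix

open Finset

/-! ### Perron vectors: existence and convergence of powers -/

variable {ι : Type*} [Fintype ι]

theorem exists_pos_forall_le (f : ι → ℝ) (hf : ∀ i, 0 < f i) : ∃ d, 0 < d ∧ ∀ i, d ≤ f i := by
  rcases isEmpty_or_nonempty ι with h | h
  · exact ⟨1, one_pos, fun i => h.elim i⟩
  · obtain ⟨i, hi⟩ := Finite.exists_min f
    exact ⟨f i, hf i, hi⟩

theorem mulVec_pos {P : Matrix ι ι ℝ} (hP : ∀ i j, 0 < P i j) {x : ι → ℝ} (hx : ∀ i, 0 ≤ x i)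
    (hx0 : x ≠ 0) (i : ι) : 0 < (P *ᵥ x) i := by
  obtain ⟨j, hj⟩ := Function.ne_iff.mp hx0
  exact sum_pos' (fun k _ => mul_nonneg (hP i k).le (hx k))
    ⟨j, mem_univ j, mul_pos (hP i j) (lt_of_le_of_ne (hx j) (Ne.symm hj))⟩

theorem dotProduct_pos_of_pos {u v : ι → ℝ} (hu : ∀ i, 0 ≤ u i) (hu0 : u ≠ 0)
    (hv : ∀ i, 0 < v i) : 0 < u ⬝ᵥ v := by
  obtain ⟨j, hj⟩ := Function.ne_iff.mp hu0
  exact sum_pos' (fun k _ => mul_nonneg (hu k) (hv k).le)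
    ⟨j, mem_univ j, mul_pos (lt_of_le_of_ne (hu j) (Ne.symm hj)) (hv j)⟩

/-- `v` is an entrywise positive right eigenvector of `T` for the eigenvalue `c`, normalized
to have entry sum `1`. -/
structure IsPerronVector (T : Matrix ι ι ℝ) (c : ℝ) (v : ι → ℝ) : Prop where
  pos : ∀ i, 0 < v i
  sum_eq_one : ∑ i, v i = 1
  mulVec_eq : T *ᵥ v = c • v

variable {T : Matrix ι ι ℝ} {c d : ℝ} {u v : ι → ℝ}

theorem IsPerronVector.ne_zero (hv : IsPerronVector T c v) : v ≠ 0 := by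
  rintro rfl
  simpa using hv.sum_eq_one

theorem IsPerronVector.vecMul_eq (hu : IsPerronVector Tᵀ c u) : u ᵥ* T = c • u := by
  rw [← hu.mulVec_eq, mulVec_transpose]

theorem IsPerronVector.dotProduct_pos (hv : IsPerronVector T c v) (hu : IsPerronVector Tᵀ d u) :
    0 < u ⬝ᵥ v :=
  dotProduct_pos_of_pos (fun i => (hu.pos i).le) hu.ne_zero hv.pos

/-- Evaluating u·(Tv) in two ways gives c(u·v) = d(u·v), and u·v > 0. -/
theorem IsPerronVector.eigenvalue_eq (hv : IsPerronVector T c v) (hu : IsPerronVector Tᵀ d u) :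
    c = d := by
  have h := dotProduct_mulVec u T v
  rw [hv.mulVec_eq, hu.vecMul_eq, dotProduct_smul, smul_dotProduct, smul_eq_mul, smul_eq_mul] at h
  exact mul_right_cancel₀ (hv.dotProduct_pos hu).ne' h

/-- If `T z > c z` entrywise for a positive vector `z`, then `c` is not the maximal
Collatz–Wielandt number of `T`. -/
theorem exists_stdSimplex_of_lt_mulVec [Nonempty ι] {z : ι → ℝ} (hz : ∀ i, 0 < z i)
    (h : ∀ i, c * z i < (T *ᵥ z) i) :
    ∃ b > c, ∃ x ∈ stdSimplex ℝ ι, ∀ i, b * x i ≤ (T *ᵥ x) i := by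
  obtain ⟨δ, hδ, hle⟩ := exists_pos_forall_le (fun i => ((T *ᵥ z) i - c * z i) / z i)
    fun i => div_pos (sub_pos.2 (h i)) (hz i)
  have hs : 0 < ∑ i, z i := sum_pos (fun i _ => hz i) univ_nonempty
  refine ⟨c + δ, by linarith, (∑ i, z i)⁻¹ • z, ⟨fun i => ?_, ?_⟩, fun i => ?_⟩
  · exact mul_nonneg (inv_nonneg.2 hs.le) (hz i).le
  · simp only [Pi.smul_apply, smul_eq_mul, ← mul_sum]
    exact inv_mul_cancel₀ hs.ne'
  · have h1 := hle i
    rw [le_div_iff₀ (hz i)] at h1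
    rw [mulVec_smul, Pi.smul_apply, Pi.smul_apply, smul_eq_mul, smul_eq_mul, mul_left_comm]
    exact mul_le_mul_of_nonneg_left (by linarith) (inv_nonneg.2 hs.le)

section DecidableEq

variable [DecidableEq ι]

theorem pow_mulVec_of_mulVec_eq (h : T *ᵥ v = c • v) (n : ℕ) : (T ^ n) *ᵥ v = c ^ n • v := by
  induction n with
  | zero => simp
  | succ n ih => rw [pow_succ, ← mulVec_mulVec, h, mulVec_smul, ih, smul_smul, pow_succ']

theorem vecMul_pow_of_vecMul_eq (h : u ᵥ* T = c • u) (n : ℕ) : u ᵥ* (T ^ n) = c ^ n • u := by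
  induction n with
  | zero => simp
  | succ n ih => rw [pow_succ, ← vecMul_vecMul, ih, smul_vecMul, h, smul_smul, pow_succ]

theorem IsPrimitive.transpose (hT : T.IsPrimitive) : Tᵀ.IsPrimitive := by
  obtain ⟨k, hk, hpos⟩ := hT.exists_pos_pow
  exact ⟨fun i j => hT.nonneg j i, k, hk, fun i j => by
    rw [← transpose_pow]; exact hpos j i⟩

theorem IsPrimitive.of_smul_le {S : Matrix ι ι ℝ} (hT : T.IsPrimitive) {a : ℝ} (ha : 0 < a)
    (h : ∀ i j, a * T i j ≤ S i j) : S.IsPrimitive := by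
  obtain ⟨k, hk, hpos⟩ := hT.exists_pos_pow
  have hS : ∀ i j, 0 ≤ S i j := fun i j => (mul_nonneg ha.le (hT.nonneg i j)).trans (h i j)
  have key : ∀ n i j, a ^ n * (T ^ n) i j ≤ (S ^ n) i j := by
    intro n
    induction n with
    | zero => simp
    | succ n ih =>
      intro i j
      rw [pow_succ T, pow_succ S, mul_apply, mul_apply, mul_sum]
      refine sum_le_sum fun l _ => ?_
      calc a ^ (n + 1) * ((T ^ n) i l * T l j) = (a ^ n * (T ^ n) i l) * (a * T l j) := by ring
        _ ≤ _ := mul_le_mul (ih i l) (h l j) (mul_nonneg ha.le (hT.nonneg l j))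
          (pow_apply_nonneg hS n i l)
  exact ⟨hS, k, hk, fun i j => (mul_pos (pow_pos ha k) (hpos i j)).trans_le (key k i j)⟩

/-- Collatz–Wielandt: maximize c subject to cx ≤ Tx with x in the simplex. At a maximum equality
must hold, as otherwise applying the positive matrix T^k to Tx - cx makes the inequality strict for
T^k x, and c could be increased. -/
theorem IsPrimitive.exists_isPerronVector [Nonempty ι] (hT : T.IsPrimitive) :
    ∃ c v, 0 < c ∧ IsPerronVector T c v := by
  obtain ⟨k, -, hpos⟩ := hT.exists_pos_pow
  -- Bounding c by the sum of all entries makes K compact and excludes no admissible c ≥ 0, as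
  -- `bound` shows.
  set K : Set (ℝ × (ι → ℝ)) :=
    (Set.Icc 0 (∑ i, ∑ j, T i j) ×ˢ stdSimplex ℝ ι) ∩ {p | ∀ i, p.1 * p.2 i ≤ (T *ᵥ p.2) i} with hK
  have hKc : IsCompact K := by
    refine (isCompact_Icc.prod (isCompact_stdSimplex ℝ ι)).inter_right ?_
    simp only [Set.ofPred_forall]
    refine isClosed_iInter fun i => isClosed_le ?_ ?_
    · fun_prop
    · exact (continuous_apply i).comp (continuous_const.matrix_mulVec continuous_snd)
  have bound : ∀ b : ℝ, ∀ x ∈ stdSimplex ℝ ι, (∀ i, b * x i ≤ (T *ᵥ x) i) →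
      b ≤ ∑ i, ∑ j, T i j := by
    intro b x hx h
    calc b = ∑ i, b * x i := by rw [← mul_sum, hx.2, mul_one]
      _ ≤ ∑ i, ∑ j, T i j := sum_le_sum fun i _ => (h i).trans <| sum_le_sum fun j _ => by
        have h1 : x j ≤ 1 := hx.2 ▸ single_le_sum (fun a _ => hx.1 a) (mem_univ j)
        exact mul_le_of_le_one_right (hT.nonneg i j) h1
  have hmem : ∀ b : ℝ, 0 ≤ b → ∀ x ∈ stdSimplex ℝ ι, (∀ i, b * x i ≤ (T *ᵥ x) i) →
      (b, x) ∈ K := fun b hb x hx h => ⟨⟨⟨hb, bound b x hx h⟩, hx⟩, h⟩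
  have hne : K.Nonempty := by
    obtain ⟨i⟩ := ‹Nonempty ι›
    refine ⟨(0, Pi.single i 1), hmem 0 le_rfl _ (single_mem_stdSimplex ℝ i) fun j => ?_⟩
    rw [zero_mul]
    exact sum_nonneg fun l _ => mul_nonneg (hT.nonneg j l) ((single_mem_stdSimplex ℝ i).1 l)
  obtain ⟨⟨c, x⟩, hcx, hmax⟩ := hKc.exists_isMaxOn hne continuous_fst.continuousOn
  have hc0 : 0 ≤ c := hcx.1.1.1
  have hx : x ∈ stdSimplex ℝ ι := hcx.1.2
  have hx0 : x ≠ 0 := by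
    rintro rfl
    simpa using hx.2
  have hTx : ∀ i, c * x i ≤ (T *ᵥ x) i := hcx.2
  have heq : T *ᵥ x = c • x := by
    by_contra hne
    have hz : ∀ i, 0 < ((T ^ k) *ᵥ x) i := mulVec_pos hpos hx.1 hx0
    have hd : ∀ i, 0 < ((T ^ k) *ᵥ (T *ᵥ x - c • x)) i :=
      mulVec_pos hpos (fun i => sub_nonneg.2 (hTx i)) (sub_ne_zero.2 hne)
    obtain ⟨b, hb, y, hy, hby⟩ := exists_stdSimplex_of_lt_mulVec (T := T) (c := c) hz fun i => by
      have h1 := hd i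
      rw [mulVec_sub, mulVec_mulVec, mulVec_smul, ← pow_succ, pow_succ', ← mulVec_mulVec] at h1
      exact sub_pos.1 h1
    exact absurd (hmax (hmem b (hc0.trans hb.le) y hy hby)) (not_le.2 hb)
  have hp : ∀ i, 0 < c ^ k * x i := fun i => by
    have := mulVec_pos hpos hx.1 hx0 i
    rwa [pow_mulVec_of_mulVec_eq heq] at this
  have hxpos : ∀ i, 0 < x i := fun i => pos_of_mul_pos_right (hp i) (pow_nonneg hc0 k)
  refine ⟨c, x, lt_of_le_of_ne hc0 ?_, hxpos, hx.2, heq⟩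
  rintro rfl
  obtain ⟨i⟩ := ‹Nonempty ι›
  -- A nonnegative matrix that kills a positive vector is zero, so it has no positive power; this
  -- rules out c = 0.
  have h1 : ∀ y : ι → ℝ, (∀ i, 0 < y i) → T *ᵥ y ≠ 0 := by
    intro y hy h0
    have hT0 : T = 0 := by
      ext a b
      have h2 := congrFun h0 a
      have h3 := (sum_eq_zero_iff_of_nonneg
        (fun l _ => mul_nonneg (hT.nonneg a l) (hy l).le)).1 h2 b (mem_univ b)
      exact (mul_eq_zero.1 h3).resolve_right (hy b).ne'
    obtain ⟨k', hk', hpos'⟩ := hT.exists_pos_pow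
    have := hpos' i i
    rw [hT0, zero_pow hk'.ne'] at this
    exact lt_irrefl _ this
  exact h1 x hxpos (by rw [heq, zero_smul])

theorem IsPrimitive.exists_isPerronVector_pair [Nonempty ι] (hT : T.IsPrimitive) :
    ∃ c v u, 0 < c ∧ IsPerronVector T c v ∧ IsPerronVector Tᵀ c u := by
  obtain ⟨c, v, hc, hv⟩ := hT.exists_isPerronVector
  obtain ⟨d, u, -, hu⟩ := hT.transpose.exists_isPerronVector
  obtain rfl := hv.eigenvalue_eq hu
  exact ⟨c, v, u, hc, hv, hu⟩

/-- Powers of a primitive matrix converge exponentially fast, after normalization, to the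
rank-one projection onto the Perron vector. -/
theorem IsPrimitive.exists_abs_pow_sub_le [Nonempty ι] (hT : T.IsPrimitive) (hc : 0 < c)
    (hv : IsPerronVector T c v) (hu : IsPerronVector Tᵀ c u) :
    ∃ ρ K : ℝ, 0 < ρ ∧ ρ < 1 ∧ ∀ n i j,
      |(T ^ n) i j - c ^ n * (v i * u j / (u ⬝ᵥ v))| ≤ K * (ρ * c) ^ n := by
  obtain ⟨k, hk, hpos⟩ := hT.exists_pos_pow
  have huv := hv.dotProduct_pos hu
  set P : Matrix ι ι ℝ := (u ⬝ᵥ v)⁻¹ • vecMulVec v u with hP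
  have hPij : ∀ i j, P i j = v i * u j / (u ⬝ᵥ v) := fun i j => by
    simp [hP, vecMulVec_apply, div_eq_inv_mul]
  have hPpos : ∀ i j, 0 < P i j := fun i j => by
    rw [hPij]; exact div_pos (mul_pos (hv.pos i) (hu.pos j)) huv
  have hPv : P *ᵥ v = v := by
    ext i
    simp only [hP, smul_mulVec, vecMulVec_mulVec, Pi.smul_apply, smul_eq_mul]
    simp
    field_simp
  have hPT : ∀ n, P * T ^ n = c ^ n • P := fun n => by
    rw [hP, smul_mul_assoc, vecMulVec_mul, vecMul_pow_of_vecMul_eq hu.vecMul_eq,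
      vecMulVec_smul, smul_comm]
  have hTP : ∀ n, T ^ n * P = c ^ n • P := fun n => by
    rw [hP, mul_smul_comm, mul_vecMulVec, pow_mulVec_of_mulVec_eq hv.mulVec_eq,
      smul_vecMulVec, smul_comm]
  have hPP : P * P = P := by
    nth_rw 2 [hP]
    rw [mul_smul_comm, mul_vecMulVec, hPv]
  obtain ⟨d, hd, hdle⟩ := exists_pos_forall_le
    (fun p : ι × ι => (T ^ k) p.1 p.2 / (c ^ k * P p.1 p.2))
    fun p => div_pos (hpos _ _) (mul_pos (pow_pos hc k) (hPpos _ _))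
  -- `d` gives T^k ≥ δ c^k P entrywise, so N is nonnegative; the cap 1/2 keeps ρ positive.
  set δ := min d (1 / 2) with hδ
  have hδ0 : 0 < δ := lt_min hd (by norm_num)
  have hδ1 : δ ≤ 1 / 2 := min_le_right _ _
  set N : Matrix ι ι ℝ := T ^ k - (δ * c ^ k) • P with hN
  have hNnn : ∀ i j, 0 ≤ N i j := fun i j => by
    have h1 := (min_le_left d (1 / 2)).trans (hdle (i, j))
    rw [le_div_iff₀ (mul_pos (pow_pos hc k) (hPpos _ _))] at h1
    simp only [hN, sub_apply, smul_apply, smul_eq_mul]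
    linarith
  have hNv : N *ᵥ v = ((1 - δ) * c ^ k) • v := by
    rw [hN, sub_mulVec, smul_mulVec, hPv, pow_mulVec_of_mulVec_eq hv.mulVec_eq, ← sub_smul]
    congr 1; ring
  set D : ℕ → Matrix ι ι ℝ := fun n => T ^ n - c ^ n • P with hD
  -- P is idempotent and PT^n = c^n P, so P D_n = 0: subtracting a multiple of P from T^k does not
  -- change its action on D_n.
  have hrec : ∀ n, D (n + k) = N * D n := fun n => by
    simp only [hD, hN, sub_mul, mul_sub, smul_mul_assoc, mul_smul_comm, hPT, hTP, hPP]
    rw [add_comm n k, pow_add T]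
    ext i j
    simp only [sub_apply, smul_apply, smul_eq_mul]
    ring
  have hk1 : (1 : ℝ) ≤ k := by exact_mod_cast hk
  -- Bernoulli's inequality gives ρ^k ≥ 1 - δ, which spreads the contraction of k steps over single
  -- steps.
  set ρ : ℝ := 1 - δ / k with hρ
  have hδk : δ / k ≤ 1 / 2 := (div_le_self hδ0.le hk1).trans hδ1
  have hρ0 : 0 < ρ := by linarith
  have hρ1 : ρ < 1 := by
    have : 0 < δ / k := div_pos hδ0 (by linarith)
    linarith
  have hρk : 1 - δ ≤ ρ ^ k := by
    have := one_add_mul_le_pow (a := -(δ / k)) (by linarith) k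
    have h2 : (k : ℝ) * -(δ / k) = -δ := by field_simp
    rw [h2] at this
    rw [hρ, sub_eq_add_neg, sub_eq_add_neg]
    exact this
  -- The row weight v i makes the bound self-reproducing: N ≥ 0 and Nv = (1 - δ)c^k v. The finitely
  -- many n < k serve as base cases.
  obtain ⟨K, hK0, hKle⟩ : ∃ K : ℝ, 0 ≤ K ∧ ∀ n < k, ∀ i j, |D n i j| ≤ K * (ρ * c) ^ n * v i := by
    refine ⟨∑ n ∈ range k, ∑ i, ∑ j, |D n i j| / ((ρ * c) ^ n * v i), ?_, ?_⟩
    · exact sum_nonneg fun n _ => sum_nonneg fun i _ => sum_nonneg fun j _ =>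
        div_nonneg (abs_nonneg _) (mul_nonneg (pow_nonneg (by positivity) _) (hv.pos i).le)
    · intro n hn i j
      have hpos' : ∀ n i, 0 < (ρ * c) ^ n * v i := fun n i => mul_pos (by positivity) (hv.pos i)
      have hnn : ∀ n i j, 0 ≤ |D n i j| / ((ρ * c) ^ n * v i) := fun n i j =>
        div_nonneg (abs_nonneg _) (hpos' n i).le
      rw [mul_assoc, ← div_le_iff₀ (hpos' n i)]
      refine le_trans ?_ (single_le_sum (f := fun n => ∑ i, ∑ j, |D n i j| / ((ρ * c) ^ n * v i))
        (fun n _ => sum_nonneg fun i _ => sum_nonneg fun j _ => hnn n i j) (mem_range.2 hn))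
      refine le_trans ?_ (single_le_sum (f := fun i => ∑ j, |D n i j| / ((ρ * c) ^ n * v i))
        (fun i _ => sum_nonneg fun j _ => hnn n i j) (mem_univ i))
      exact single_le_sum (f := fun j => |D n i j| / ((ρ * c) ^ n * v i))
        (fun j _ => hnn n i j) (mem_univ j)
  have hall : ∀ n i j, |D n i j| ≤ K * (ρ * c) ^ n * v i := by
    intro n
    induction n using Nat.strong_induction_on with
    | _ n ih =>
      intro i j
      rcases lt_or_ge n k with hn | hn
      · exact hKle n hn i j
      · obtain ⟨p, rfl⟩ : ∃ p, n = p + k := ⟨n - k, by omega⟩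
        rw [hrec, mul_apply]
        calc |∑ l, N i l * D p l j| ≤ ∑ l, |N i l * D p l j| := abs_sum_le_sum_abs _ _
          _ ≤ ∑ l, N i l * (K * (ρ * c) ^ p * v l) := sum_le_sum fun l _ => by
            rw [abs_mul, abs_of_nonneg (hNnn i l)]
            exact mul_le_mul_of_nonneg_left (ih p (by omega) l j) (hNnn i l)
          _ = K * (ρ * c) ^ p * (N *ᵥ v) i := by
            rw [mulVec, dotProduct, mul_sum]
            exact sum_congr rfl fun l _ => by ring
          _ = K * (ρ * c) ^ p * v i * c ^ k * (1 - δ) := by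
            rw [hNv, Pi.smul_apply, smul_eq_mul]; ring
          _ ≤ K * (ρ * c) ^ p * v i * c ^ k * ρ ^ k := by
            refine mul_le_mul_of_nonneg_left hρk ?_
            have := (hv.pos i).le
            positivity
          _ = K * (ρ * c) ^ (p + k) * v i := by rw [pow_add, mul_pow ρ c k]; ring
  refine ⟨ρ, K, hρ0, hρ1, fun n i j => ?_⟩
  have h1 : v i ≤ 1 := hv.sum_eq_one ▸ single_le_sum (fun a _ => (hv.pos a).le) (mem_univ i)
  rw [← hPij]
  exact (hall n i j).trans (mul_le_of_le_one_right (by positivity) h1)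

theorem IsPrimitive.tendsto_pow_div_pow [Nonempty ι] (hT : T.IsPrimitive) (hc : 0 < c)
    (hv : IsPerronVector T c v) (hu : IsPerronVector Tᵀ c u) (i j : ι) :
    Filter.Tendsto (fun n : ℕ => (T ^ n) i j / c ^ n) Filter.atTop
      (nhds (v i * u j / (u ⬝ᵥ v))) := by
  obtain ⟨ρ, K, hρ0, hρ1, hle⟩ := hT.exists_abs_pow_sub_le hc hv hu
  have h0 : Filter.Tendsto (fun n : ℕ => K * ρ ^ n) Filter.atTop (nhds 0) := by
    simpa using (tendsto_pow_atTop_nhds_zero_of_lt_one hρ0.le hρ1).const_mul K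
  rw [tendsto_iff_norm_sub_tendsto_zero]
  refine squeeze_zero (fun n => norm_nonneg _) (fun n => ?_) h0
  have hcn : 0 < c ^ n := pow_pos hc n
  have h1 : (T ^ n) i j / c ^ n - v i * u j / (u ⬝ᵥ v)
      = ((T ^ n) i j - c ^ n * (v i * u j / (u ⬝ᵥ v))) / c ^ n := by
    field_simp
  rw [h1, Real.norm_eq_abs, abs_div, abs_of_pos hcn, div_le_iff₀ hcn, mul_assoc, ← mul_pow]
  exact hle n i j

end DecidableEq

end Matrix

/-! ### Uniqueness, spectral gap and analytic dependence -/

namespace Matrix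

open Finset Filter Topology ContDiff

variable {ι : Type*} [Fintype ι] [DecidableEq ι] [Nonempty ι]
  {T : Matrix ι ι ℝ} {c : ℝ} {u v : ι → ℝ}

/-- The powers of `T / c`, applied to a vector over `ℝ` or `ℂ`, converge to the projection of
the vector onto the Perron line. -/
theorem IsPrimitive.tendsto_pow_div_pow_mulVec {𝕜 : Type*} [RCLike 𝕜] (hT : T.IsPrimitive)
    (hc : 0 < c) (hv : IsPerronVector T c v) (hu : IsPerronVector Tᵀ c u) (w : ι → 𝕜) (i : ι) :
    Tendsto (fun n : ℕ => (((T.map (RCLike.ofReal : ℝ → 𝕜)) ^ n) *ᵥ w) i / (c : 𝕜) ^ n) atTop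
      (𝓝 (((v i / (u ⬝ᵥ v) : ℝ) : 𝕜) * ∑ j, (u j : 𝕜) * w j)) := by
  have hpow : ∀ n : ℕ, (T.map (RCLike.ofReal : ℝ → 𝕜)) ^ n = (T ^ n).map RCLike.ofReal :=
    fun n => (map_pow (RingHom.mapMatrix (algebraMap ℝ 𝕜)) T n).symm
  have h : ∀ n : ℕ, (((T.map (RCLike.ofReal : ℝ → 𝕜)) ^ n) *ᵥ w) i / (c : 𝕜) ^ n
      = ∑ j, (((T ^ n) i j / c ^ n : ℝ) : 𝕜) * w j := fun n => by
    rw [hpow, mulVec, dotProduct, sum_div]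
    refine sum_congr rfl fun j _ => ?_
    simp only [map_apply]
    push_cast
    ring
  simp_rw [h]
  have h2 : ((v i / (u ⬝ᵥ v) : ℝ) : 𝕜) * ∑ j, (u j : 𝕜) * w j
      = ∑ j, ((v i * u j / (u ⬝ᵥ v) : ℝ) : 𝕜) * w j := by
    rw [mul_sum]
    refine sum_congr rfl fun j _ => ?_
    push_cast
    ring
  rw [h2]
  exact tendsto_finsetSum _ fun j _ =>
    ((RCLike.continuous_ofReal.tendsto _).comp (hT.tendsto_pow_div_pow hc hv hu i j)).mul_const _

/-- For an eigenvector w the sequence T^n w / c^n is constant, yet it converges to the projection of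
w onto the line of v. -/
theorem IsPrimitive.eq_smul_of_mulVec_eq (hT : T.IsPrimitive) (hc : 0 < c)
    (hv : IsPerronVector T c v) (hu : IsPerronVector Tᵀ c u) {w : ι → ℝ}
    (hw : T *ᵥ w = c • w) : w = ((u ⬝ᵥ w) / (u ⬝ᵥ v)) • v := by
  ext i
  have h := hT.tendsto_pow_div_pow_mulVec hc hv hu w i
  have h1 : T.map (RCLike.ofReal : ℝ → ℝ) = T := by ext; simp
  simp only [h1, pow_mulVec_of_mulVec_eq hw] at h
  have h2 : ∀ n : ℕ, (c ^ n • w) i / ((c : ℝ) : ℝ) ^ n = w i := fun n => by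
    have := pow_pos hc n
    simp only [Pi.smul_apply, smul_eq_mul]
    field_simp
  have h3 := tendsto_nhds_unique h (tendsto_const_nhds.congr fun n => (h2 n).symm)
  rw [← h3]
  simp only [RCLike.ofReal_real_eq_id, id_eq, Pi.smul_apply, smul_eq_mul, dotProduct]
  ring

/-- Pairing with one left Perron vector fixes the eigenvalue; the eigenspace is a line, and entry
sum 1 fixes the scalar. -/
theorem IsPrimitive.isPerronVector_unique (hT : T.IsPrimitive) {c' : ℝ} {v' : ι → ℝ}
    (hv : IsPerronVector T c v) (hv' : IsPerronVector T c' v') : c' = c ∧ v' = v := by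
  obtain ⟨d, w, u, hd, hw, hu⟩ := hT.exists_isPerronVector_pair
  have key : ∀ {b x}, IsPerronVector T b x → b = d ∧ x = w := by
    intro b x hx
    obtain rfl := hx.eigenvalue_eq hu
    refine ⟨rfl, ?_⟩
    have h := hT.eq_smul_of_mulVec_eq hd hw hu hx.mulVec_eq
    have h1 := hx.sum_eq_one
    rw [h] at h1
    simp only [Pi.smul_apply, smul_eq_mul, ← mul_sum, hw.sum_eq_one, mul_one] at h1
    rw [h, h1, one_smul]
  exact ⟨(key hv').1.trans (key hv).1.symm, (key hv').2.trans (key hv).2.symm⟩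

theorem IsPrimitive.perron_eigenvalue_pos (hT : T.IsPrimitive) (hv : IsPerronVector T c v) :
    0 < c := by
  obtain ⟨d, w, hd, hw⟩ := hT.exists_isPerronVector
  rw [(hT.isPerronVector_unique hw hv).1]
  exact hd

/-- The left Perron vector annihilates w because z ≠ c. The limit of T^n w / c^n = (z/c)^n w is thus
zero, which forces ‖z‖ < c. -/
theorem IsPrimitive.norm_lt_of_mulVec_eq (hT : T.IsPrimitive)
    (hv : IsPerronVector T c v) (hu : IsPerronVector Tᵀ c u) {z : ℂ} {w : ι → ℂ}
    (hw : (T.map Complex.ofReal) *ᵥ w = z • w) (hw0 : w ≠ 0) (hz : z ≠ c) : ‖z‖ < c := by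
  have hc := hT.perron_eigenvalue_pos hv
  have huw : (fun j => (u j : ℂ)) ⬝ᵥ w = 0 := by
    have h := dotProduct_mulVec (fun j => (u j : ℂ)) (T.map Complex.ofReal) w
    have h1 : (fun j => (u j : ℂ)) ᵥ* (T.map Complex.ofReal) = (c : ℂ) • fun j => (u j : ℂ) := by
      ext j
      have := congrFun hu.vecMul_eq j
      simp only [vecMul, dotProduct, Pi.smul_apply, smul_eq_mul, map_apply] at this ⊢
      exact_mod_cast congrArg Complex.ofReal this
    rw [hw, h1, dotProduct_smul, smul_dotProduct, smul_eq_mul, smul_eq_mul] at h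
    by_contra h0
    exact hz (mul_right_cancel₀ h0 h)
  obtain ⟨i, hi⟩ := Function.ne_iff.mp hw0
  have hpow : ∀ n : ℕ, ((T.map Complex.ofReal) ^ n) *ᵥ w = z ^ n • w := by
    intro n
    induction n with
    | zero => simp
    | succ n ih => rw [pow_succ, ← mulVec_mulVec, hw, mulVec_smul, ih, smul_smul, pow_succ']
  have h := hT.tendsto_pow_div_pow_mulVec hc hv hu w i
  change Tendsto (fun n : ℕ => (((T.map Complex.ofReal) ^ n) *ᵥ w) i / (c : ℂ) ^ n) atTop
    (𝓝 (_ * ((fun j => (u j : ℂ)) ⬝ᵥ w))) at h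
  rw [huw, mul_zero] at h
  have h2 : Tendsto (fun n : ℕ => (z / c) ^ n) atTop (𝓝 0) := by
    have h3 := h.div_const (w i)
    rw [zero_div] at h3
    refine h3.congr fun n => ?_
    have hi' : w i ≠ 0 := hi
    rw [hpow, Pi.smul_apply, smul_eq_mul, div_pow]
    field_simp
  rw [tendsto_pow_atTop_nhds_zero_iff_norm_lt_one, norm_div, Complex.norm_real,
    Real.norm_of_nonneg hc.le, div_lt_one hc] at h2
  exact h2

theorem IsPrimitive.isPerronFrobeniusEigenvalue {m : ℕ} [Nonempty (Fin m)]
    {T : Matrix (Fin m) (Fin m) ℝ} {v : Fin m → ℝ} (hT : T.IsPrimitive)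
    (hv : IsPerronVector T c v) : IsPerronFrobeniusEigenvalue T c := by
  obtain ⟨d, w, u, hd, hw, hu⟩ := hT.exists_isPerronVector_pair
  obtain ⟨rfl, rfl⟩ := hT.isPerronVector_unique hw hv
  refine ⟨hd, ?_, fun z hz hne => ?_⟩
  · refine Module.End.hasEigenvalue_of_hasEigenvector (x := fun j => (v j : ℂ))
      (Module.End.hasEigenvector_iff.2 ⟨Module.End.mem_eigenspace_iff.2 ?_, fun h => ?_⟩)
    · ext i
      have := congrFun hv.mulVec_eq i
      simp only [toLin'_apply, mulVec, dotProduct, Pi.smul_apply, smul_eq_mul, map_apply] at this ⊢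
      exact_mod_cast congrArg Complex.ofReal this
    · refine hv.ne_zero (funext fun i => ?_)
      simpa using congrFun h i
  · obtain ⟨x, hx⟩ := hz.exists_hasEigenvector
    refine hT.norm_lt_of_mulVec_eq hv hu ?_ hx.2 hne
    simpa using hx.apply_eq_smul

/-- The Perron eigenvalue and the normalized Perron vector of a primitive matrix depend
analytically on the entries of the matrix. -/
theorem analyticAt_perron {E : Type*} [NormedAddCommGroup E] [NormedSpace ℝ E] [CompleteSpace E]
    {T : E → Matrix ι ι ℝ} {c : E → ℝ} {v : E → ι → ℝ} {t₀ : E}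
    (hT : ∀ t, (T t).IsPrimitive) (hTa : ∀ i j, AnalyticAt ℝ (fun t => T t i j) t₀)
    (hv : ∀ t, IsPerronVector (T t) (c t) (v t)) :
    AnalyticAt ℝ c t₀ ∧ AnalyticAt ℝ v t₀ := by
  -- The normalization equation makes the system square in the unknowns (v, c).
  set F : E × ((ι → ℝ) × ℝ) → (ι → ℝ) × ℝ := fun p =>
    (fun i => ∑ j, T p.1 i j * p.2.1 j - p.2.2 * p.2.1 i, ∑ j, p.2.1 j - 1) with hF
  set p₀ : E × ((ι → ℝ) × ℝ) := (t₀, (v t₀, c t₀)) with hp₀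
  have hcd : ContDiffAt ℝ ω F p₀ := by
    refine ContDiffAt.prodMk (contDiffAt_pi.2 fun i => ?_) (by fun_prop)
    refine ContDiffAt.sub (ContDiffAt.sum fun j _ => ContDiffAt.mul ?_ (by fun_prop))
      (by fun_prop)
    exact ContDiffAt.comp p₀ (g := fun t => T t i j) (hTa i j).contDiffAt contDiffAt_fst
  have hF0 : F p₀ = 0 := by
    refine Prod.ext (funext fun i => ?_) ?_
    · have := congrFun (hv t₀).mulVec_eq i
      simpa [hF, hp₀, sub_eq_zero, mulVec, dotProduct] using this
    · simpa [hF, hp₀, sub_eq_zero] using (hv t₀).sum_eq_one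
  have hω : (ω : WithTop ℕ∞) ≠ 0 := by simp
  set L := fderiv ℝ F p₀ ∘L .inr ℝ E ((ι → ℝ) × ℝ) with hL
  have hLapply : ∀ w s, L (w, s) =
      (fun i => ∑ j, T t₀ i j * w j - (s * v t₀ i + c t₀ * w i), ∑ j, w j) := by
    intro w s
    have h1 : HasDerivAt (fun ε : ℝ => F (t₀, (v t₀ + ε • w, c t₀ + ε * s))) (L (w, s)) 0 := by
      have hf : HasFDerivAt F (fderiv ℝ F p₀) (t₀, (v t₀ + (0 : ℝ) • w, c t₀ + 0 * s)) := by
        simpa [hp₀] using (hcd.differentiableAt hω).hasFDerivAt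
      have hg : HasDerivAt (fun ε : ℝ => (t₀, (v t₀ + ε • w, c t₀ + ε * s))) (0, (w, s)) 0 := by
        refine (hasDerivAt_const _ _).prodMk (HasDerivAt.prodMk ?_ ?_)
        · simpa using ((hasDerivAt_id (0 : ℝ)).smul_const w).const_add (v t₀)
        · simpa using ((hasDerivAt_id (0 : ℝ)).mul_const s).const_add (c t₀)
      exact hf.comp_hasDerivAt 0 hg
    refine h1.unique (HasDerivAt.prodMk (hasDerivAt_pi.2 fun i => ?_) ?_)
    · have hl : ∀ j, HasDerivAt (fun ε : ℝ => (v t₀ + ε • w) j) (w j) 0 := fun j => by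
        simpa using ((hasDerivAt_id (0 : ℝ)).mul_const (w j)).const_add (v t₀ j)
      have hs : HasDerivAt (fun ε : ℝ => c t₀ + ε * s) s 0 := by
        simpa using ((hasDerivAt_id (0 : ℝ)).mul_const s).const_add (c t₀)
      refine (HasDerivAt.fun_sum fun j _ => (hl j).const_mul (T t₀ i j)).sub ?_
      simpa using hs.fun_mul (hl i)
    · have hl : ∀ j, HasDerivAt (fun ε : ℝ => (v t₀ + ε • w) j) (w j) 0 := fun j => by
        simpa using ((hasDerivAt_id (0 : ℝ)).mul_const (w j)).const_add (v t₀ j)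
      exact (HasDerivAt.fun_sum fun j _ => hl j).sub_const 1
  -- For (w, s) in the kernel, pairing with u gives s(u·v) = 0, so s = 0. Then w is a multiple of v
  -- with entry sum 0, hence w = 0.
  have hinj : Function.Injective L := by
    rw [injective_iff_map_eq_zero]
    rintro ⟨w, s⟩ h
    rw [hLapply, Prod.mk_eq_zero] at h
    obtain ⟨h1, h2⟩ := h
    obtain ⟨d, x, u, hd, hx, hu⟩ := (hT t₀).exists_isPerronVector_pair
    obtain ⟨rfl, rfl⟩ := (hT t₀).isPerronVector_unique (hv t₀) hx
    have h3 : T t₀ *ᵥ w = s • v t₀ + c t₀ • w := by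
      ext i
      exact sub_eq_zero.1 (congrFun h1 i)
    have hs : s = 0 := by
      have h4 := dotProduct_mulVec u (T t₀) w
      rw [h3, hu.vecMul_eq, dotProduct_add, dotProduct_smul, dotProduct_smul, smul_dotProduct,
        add_eq_right, smul_eq_mul] at h4
      exact (mul_eq_zero.1 h4).resolve_right (hx.dotProduct_pos hu).ne'
    rw [hs, zero_smul, zero_add] at h3
    have h5 := (hT t₀).eq_smul_of_mulVec_eq hd hx hu h3
    have h6 := h2
    rw [h5] at h6
    simp only [Pi.smul_apply, smul_eq_mul, ← mul_sum, hx.sum_eq_one, mul_one] at h6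
    rw [h6, zero_smul] at h5
    rw [h5, hs]; rfl
  have hinv : L.IsInvertible :=
    ⟨(LinearEquiv.ofInjectiveEndo (L : ((ι → ℝ) × ℝ) →ₗ[ℝ] (ι → ℝ) × ℝ)
      hinj).toContinuousLinearEquiv, by ext x <;> rfl⟩
  set ψ := hcd.implicitFunction hω hinv with hψ
  have hψa : AnalyticAt ℝ ψ t₀ := (hcd.contDiffAt_implicitFunction hω hinv).analyticAt
  have hψ0 : ψ t₀ = (v t₀, c t₀) := hcd.implicitFunction_apply_self hω hinv
  -- The implicit solution is only known to be a normalized eigenpair. Positivity, an open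
  -- condition, makes it a Perron vector, which uniqueness identifies with (v t, c t).
  have hpos : ∀ᶠ t in 𝓝 t₀, ∀ i, 0 < (ψ t).1 i := by
    refine eventually_all.2 fun i => ?_
    have hcont : ContinuousAt (fun t => (ψ t).1 i) t₀ :=
      (continuous_apply i).continuousAt.comp (continuousAt_fst.comp hψa.continuousAt)
    refine hcont.eventually (lt_mem_nhds ?_)
    change 0 < (ψ t₀).1 i
    rw [hψ0]
    exact (hv t₀).pos i
  have heq : ∀ᶠ t in 𝓝 t₀, (ψ t).2 = c t ∧ (ψ t).1 = v t := by
    filter_upwards [hpos, hcd.eventually_apply_implicitFunction hω hinv] with t ht1 ht2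
    rw [hF0, Prod.mk_eq_zero] at ht2
    refine (hT t).isPerronVector_unique (hv t) ⟨ht1, sub_eq_zero.1 ht2.2, ?_⟩
    ext i
    exact sub_eq_zero.1 (congrFun ht2.1 i)
  exact ⟨(analyticAt_snd.comp hψa).congr (heq.mono fun t h => h.1),
    (analyticAt_fst.comp hψa).congr (heq.mono fun t h => h.2)⟩

end Matrix

/-! ### Relative errors of quotients -/

open Filter Asymptotics Matrix Topology

/-- The relative error of the quotient of two sequences with exponentially small relative errors
is exponentially small. -/
theorem isBigO_div_div_sub_one {a b : ℕ → ℝ} {c d C D ρ σ K L : ℝ} (hc : 0 < c) (hd : 0 < d)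
    (hC : 0 < C) (hD : 0 < D) (hρ : 0 < ρ) (hρ1 : ρ < 1) (hσ : 0 < σ) (hσ1 : σ < 1)
    (ha : ∀ n, |a n - c ^ n * C| ≤ K * (ρ * c) ^ n)
    (hb : ∀ n, |b n - d ^ n * D| ≤ L * (σ * d) ^ n) :
    (fun n => a n / b n / (C / D * (c / d) ^ n) - 1) =O[atTop] fun n : ℕ => (max ρ σ) ^ n := by
  have aux : ∀ {a : ℕ → ℝ} {c C ρ K : ℝ} (ε : ℝ), 0 < c → 0 < ρ → ρ ≤ ε →
      (∀ n, |a n - c ^ n * C| ≤ K * (ρ * c) ^ n) →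
      (fun n => a n / c ^ n - C) =O[atTop] fun n : ℕ => ε ^ n := by
    intro a c C ρ K ε hc hρ hε ha
    refine IsBigO.of_bound |K| (Eventually.of_forall fun n => ?_)
    have hcn := pow_pos hc n
    have h1 : a n / c ^ n - C = (a n - c ^ n * C) / c ^ n := by field_simp
    rw [h1, norm_div, Real.norm_eq_abs, Real.norm_of_nonneg hcn.le, div_le_iff₀ hcn,
      Real.norm_of_nonneg (pow_nonneg (hρ.le.trans hε) n), mul_assoc, ← mul_pow]
    refine (ha n).trans (mul_le_mul (le_abs_self K) ?_ (by positivity) (abs_nonneg K))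
    exact pow_le_pow_left₀ (by positivity) (mul_le_mul_of_nonneg_right hε hc.le) n
  have he := aux (max ρ σ) hc hρ (le_max_left _ _) ha
  have hf := aux (max ρ σ) hd hσ (le_max_right _ _) hb
  have hf0 : Tendsto (fun n => b n / d ^ n - D) atTop (𝓝 0) :=
    hf.trans_tendsto (tendsto_pow_atTop_nhds_zero_of_lt_one (hρ.le.trans (le_max_left _ _))
      (max_lt hρ1 hσ1))
  have hg : Tendsto (fun n => b n / d ^ n) atTop (𝓝 D) := by
    simpa using hf0.add_const D
  have hinv : (fun n => (C * (b n / d ^ n))⁻¹) =O[atTop] fun _ : ℕ => (1 : ℝ) :=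
    ((hg.const_mul C).inv₀ (mul_pos hC hD).ne').isBigO_one ℝ
  -- With e = a/c^n - C and f = b/d^n - D, the relative error equals (De - Cf) / (C · b/d^n), and
  -- the denominator tends to CD > 0.
  have hmain := ((he.const_mul_left D).sub (hf.const_mul_left C)).mul hinv
  simp only [mul_one] at hmain
  refine hmain.congr' ?_ EventuallyEq.rfl
  filter_upwards [hg.eventually (lt_mem_nhds hD)] with n hn
  have hcn := pow_pos hc n
  have hdn := pow_pos hd n
  have hbn : b n ≠ 0 := by
    intro h
    rw [h, zero_div] at hn
    exact lt_irrefl _ hn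
  rw [div_pow]
  field_simp
  ring

/-! ### Words and powers of the tilted matrix -/

theorem toWord_cons {ℓ n : ℕ} (x : Letter ℓ) (w : Fin n → Letter ℓ) :
    toWord (Fin.cons x w : Fin (n + 1) → Letter ℓ) = FreeMonoid.of x * toWord w := by
  simp only [toWord, List.ofFn_cons]
  rfl

namespace LinearRepresentation

variable {ℓ m : ℕ} (R : LinearRepresentation ℓ m)

theorem exp_sum_symbolCount_cons {n : ℕ} (t : Fin ℓ → ℝ) (x : Letter ℓ) (w : Fin n → Letter ℓ) :
    Real.exp (∑ i, t i * (symbolCount (Fin.cons x w : Fin (n + 1) → Letter ℓ) i : ℝ)) =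
      x.elim 1 (fun i => Real.exp (t i)) * Real.exp (∑ i, t i * (symbolCount w i : ℝ)) := by
  have h : ∀ i, (symbolCount (Fin.cons x w : Fin (n + 1) → Letter ℓ) i : ℝ) =
      (symbolCount w i : ℝ) + if x = some i then 1 else 0 := fun i => by
    have h1 : (toWord (Fin.cons x w : Fin (n + 1) → Letter ℓ)).toList = x :: (toWord w).toList := by
      rw [toWord_cons]; rfl
    simp only [symbolCount, h1, List.count_cons, beq_iff_eq]
    push_cast
    rfl
  simp only [h, mul_add, Finset.sum_add_distrib, Real.exp_add]
  rw [mul_comm]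
  congr 1
  cases x with
  | none => simp
  | some j => simp

theorem tiltedMatrix_eq_sum (t : Fin ℓ → ℝ) :
    R.tiltedMatrix t = ∑ x : Letter ℓ, x.elim 1 (fun i => Real.exp (t i)) •
      wordMatrix R.A R.B (FreeMonoid.of x) := by
  rw [Fintype.sum_option, add_comm]
  simp [tiltedMatrix, wordMatrix]

/-- This is the noncommutative expansion of M(t)^n over words, obtained by splitting off the first
letter. -/
theorem sum_exp_smul_wordMatrix (t : Fin ℓ → ℝ) (n : ℕ) :
    ∑ w : Fin n → Letter ℓ, Real.exp (∑ i, t i * (symbolCount w i : ℝ)) •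
      wordMatrix R.A R.B (toWord w) = R.tiltedMatrix t ^ n := by
  induction n with
  | zero => simp [symbolCount, toWord]
  | succ n ih =>
    rw [← (Fin.consEquiv fun _ => Letter ℓ).sum_comp, Fintype.sum_prod_type, pow_succ', ← ih,
      tiltedMatrix_eq_sum, Finset.sum_mul_sum]
    refine Finset.sum_congr rfl fun x _ => Finset.sum_congr rfl fun w _ => ?_
    change Real.exp (∑ i, t i * (symbolCount (Fin.cons x w : Fin (n + 1) → Letter ℓ) i : ℝ)) •
      wordMatrix R.A R.B (toWord (Fin.cons x w : Fin (n + 1) → Letter ℓ)) = _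
    rw [exp_sum_symbolCount_cons, toWord_cons, map_mul, smul_mul_smul_comm]

theorem sum_series_mul_exp (t : Fin ℓ → ℝ) (n : ℕ) :
    ∑ w : Fin n → Letter ℓ, R.series (toWord w) * Real.exp (∑ i, t i * (symbolCount w i : ℝ)) =
      R.ξ ⬝ᵥ (R.tiltedMatrix t ^ n *ᵥ R.η) := by
  rw [← sum_exp_smul_wordMatrix, sum_mulVec, dotProduct_sum]
  refine Finset.sum_congr rfl fun w _ => ?_
  rw [smul_mulVec, dotProduct_smul, smul_eq_mul, mul_comm, series]

theorem tiltedMatrix_zero : R.tiltedMatrix 0 = R.totalMatrix := by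
  simp [tiltedMatrix, totalMatrix]

theorem totalWeight_eq (n : ℕ) :
    R.totalWeight n = R.ξ ⬝ᵥ (R.tiltedMatrix 0 ^ n *ᵥ R.η) := by
  rw [← sum_series_mul_exp, totalWeight]
  simp

theorem momentGen_eq (n : ℕ) (t : Fin ℓ → ℝ) :
    R.momentGen n t = R.ξ ⬝ᵥ (R.tiltedMatrix t ^ n *ᵥ R.η) /
      (R.ξ ⬝ᵥ (R.tiltedMatrix 0 ^ n *ᵥ R.η)) := by
  rw [← totalWeight_eq, ← sum_series_mul_exp, Finset.sum_div]
  exact Finset.sum_congr rfl fun w _ => div_mul_eq_mul_div _ _ _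

theorem ξ_ne_zero : R.ξ ≠ 0 := by
  intro h
  obtain ⟨n, w, hw⟩ := R.exists_pos.exists
  rw [h, zero_dotProduct] at hw
  exact lt_irrefl _ hw

theorem η_ne_zero : R.η ≠ 0 := by
  intro h
  obtain ⟨n, w, hw⟩ := R.exists_pos.exists
  rw [h, mulVec_zero, dotProduct_zero] at hw
  exact lt_irrefl _ hw

/-- The condition m ≥ 1 need not be imposed: words of positive weight force ξ ≠ 0. -/
theorem nonempty_state {ℓ m : ℕ} (R : LinearRepresentation ℓ m) : Nonempty (Fin m) :=
  let ⟨j, _⟩ := Function.ne_iff.mp R.ξ_ne_zero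
  ⟨j⟩

/-- Both e^{t_i} and 1 are at least e^{-∑|t_j|}, so M(t) dominates that multiple of M entrywise. -/
theorem isPrimitive_tiltedMatrix (hM : R.totalMatrix.IsPrimitive) (t : Fin ℓ → ℝ) :
    (R.tiltedMatrix t).IsPrimitive := by
  refine hM.of_smul_le (Real.exp_pos (-∑ i, |t i|)) fun j k => ?_
  simp only [totalMatrix, tiltedMatrix, Matrix.add_apply, Matrix.sum_apply, Matrix.smul_apply,
    smul_eq_mul, mul_add, Finset.mul_sum]
  have hs : 0 ≤ ∑ i, |t i| := Finset.sum_nonneg fun i _ => abs_nonneg _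
  refine add_le_add (Finset.sum_le_sum fun i _ => ?_) ?_
  · refine mul_le_mul_of_nonneg_right (Real.exp_le_exp.2 ?_) (R.A_nonneg i j k)
    have h1 : |t i| ≤ ∑ i, |t i| :=
      Finset.single_le_sum (f := fun i => |t i|) (fun i _ => abs_nonneg _) (Finset.mem_univ i)
    linarith [neg_abs_le (t i)]
  · exact mul_le_of_le_one_left (R.B_nonneg j k) (Real.exp_le_one_iff.2 (by linarith))

theorem analyticAt_tiltedMatrix (t : Fin ℓ → ℝ) (j k : Fin m) :
    AnalyticAt ℝ (fun s => R.tiltedMatrix s j k) t := by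
  simp only [tiltedMatrix, Matrix.add_apply, Matrix.sum_apply, Matrix.smul_apply, smul_eq_mul]
  refine (Finset.analyticAt_fun_sum _ fun i _ => ?_).add analyticAt_const
  refine AnalyticAt.mul ?_ analyticAt_const
  exact AnalyticAt.rexp ((ContinuousLinearMap.proj (R := ℝ) (φ := fun _ : Fin ℓ => ℝ) i).analyticAt t)

end LinearRepresentation

/-! ### Quasi-power asymptotics -/

theorem Matrix.IsPrimitive.exists_abs_dotProduct_pow_mulVec_sub_le {ι : Type*} [Fintype ι]
    [DecidableEq ι] [Nonempty ι] {T : Matrix ι ι ℝ} {c : ℝ} {u v : ι → ℝ} (hT : T.IsPrimitive)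
    (hv : IsPerronVector T c v) (hu : IsPerronVector Tᵀ c u) (x y : ι → ℝ) :
    ∃ ρ K : ℝ, 0 < ρ ∧ ρ < 1 ∧ ∀ n,
      |x ⬝ᵥ (T ^ n *ᵥ y) - c ^ n * ((x ⬝ᵥ v) * (u ⬝ᵥ y) / (u ⬝ᵥ v))| ≤ K * (ρ * c) ^ n := by
  have hc := hT.perron_eigenvalue_pos hv
  obtain ⟨ρ, K, hρ, hρ1, h⟩ := hT.exists_abs_pow_sub_le hc hv hu
  refine ⟨ρ, ∑ i, ∑ j, |x i| * |y j| * K, hρ, hρ1, fun n => ?_⟩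
  have h1 : x ⬝ᵥ (T ^ n *ᵥ y) - c ^ n * ((x ⬝ᵥ v) * (u ⬝ᵥ y) / (u ⬝ᵥ v)) =
      ∑ i, ∑ j, x i * y j * ((T ^ n) i j - c ^ n * (v i * u j / (u ⬝ᵥ v))) := by
    have h2 : (x ⬝ᵥ v) * (u ⬝ᵥ y) = ∑ i, ∑ j, x i * v i * (u j * y j) := by
      simp only [dotProduct, Finset.sum_mul_sum]
    have h3 : x ⬝ᵥ (T ^ n *ᵥ y) = ∑ i, ∑ j, x i * ((T ^ n) i j * y j) := by
      simp only [dotProduct, mulVec, Finset.mul_sum]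
    rw [h2, h3]
    simp only [Finset.sum_div, Finset.mul_sum, ← Finset.sum_sub_distrib]
    exact Finset.sum_congr rfl fun i _ => Finset.sum_congr rfl fun j _ => by ring
  rw [h1]
  simp only [Finset.sum_mul]
  refine (Finset.abs_sum_le_sum_abs _ _).trans (Finset.sum_le_sum fun i _ => ?_)
  refine (Finset.abs_sum_le_sum_abs _ _).trans (Finset.sum_le_sum fun j _ => ?_)
  rw [abs_mul, abs_mul, mul_assoc (|x i| * |y j|)]
  exact mul_le_mul_of_nonneg_left (h n i j) (by positivity)

/-- Quasi-power form of the moment generating functions in the primitive case.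
The numbers `lam` and `y t` are determined by the first two clauses
(see `IsPerronFrobeniusEigenvalue.unique`). -/
theorem theorem4p1 {ℓ m : ℕ} (R : LinearRepresentation ℓ m)
    (hM : R.totalMatrix.IsPrimitive) :
    ∃ (lam : ℝ) (y r : (Fin ℓ → ℝ) → ℝ),
      IsPerronFrobeniusEigenvalue R.totalMatrix lam ∧
      (∀ t, IsPerronFrobeniusEigenvalue (R.tiltedMatrix t) (y t)) ∧
      (∀ t, AnalyticAt ℝ y t) ∧
      (∀ t, AnalyticAt ℝ r t) ∧
      (∀ t, 0 < r t) ∧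
      r 0 = 1 ∧
      ∀ t : Fin ℓ → ℝ, ∃ ε : ℝ, 0 < ε ∧ ε < 1 ∧ ∃ δ : ℕ → ℝ,
        δ =O[Filter.atTop] (fun n : ℕ => ε ^ n) ∧
        ∀ n : ℕ, 0 < R.totalWeight n →
          R.momentGen n t = r t * (y t / lam) ^ n * (1 + δ n) := by
  have := R.nonempty_state
  have hT := R.isPrimitive_tiltedMatrix hM
  choose y v u hy hv hu using fun t => (hT t).exists_isPerronVector_pair
  have hva := fun t => analyticAt_perron (t₀ := t) hT (R.analyticAt_tiltedMatrix t) hv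
  -- Left Perron vectors are right ones of the transpose, so the same analyticity result applies to
  -- u.
  have hua := fun t => analyticAt_perron (t₀ := t) (fun s => (hT s).transpose)
    (fun i j => R.analyticAt_tiltedMatrix t j i) hu
  set C : (Fin ℓ → ℝ) → ℝ := fun t => (R.ξ ⬝ᵥ v t) * (u t ⬝ᵥ R.η) / (u t ⬝ᵥ v t) with hC
  have huv : ∀ t, 0 < u t ⬝ᵥ v t := fun t => (hv t).dotProduct_pos (hu t)
  have hCpos : ∀ t, 0 < C t := fun t => by
    refine div_pos (mul_pos ?_ ?_) (huv t)
    · exact dotProduct_pos_of_pos R.ξ_nonneg R.ξ_ne_zero (hv t).pos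
    · rw [dotProduct_comm]
      exact dotProduct_pos_of_pos R.η_nonneg R.η_ne_zero (hu t).pos
  have hCa : ∀ t, AnalyticAt ℝ C t := fun t => by
    have hvi := analyticAt_pi_iff.1 (hva t).2
    have hui := analyticAt_pi_iff.1 (hua t).2
    refine AnalyticAt.div (AnalyticAt.mul ?_ ?_) ?_ (huv t).ne'
    · exact Finset.analyticAt_fun_sum _ fun i _ => analyticAt_const.mul (hvi i)
    · exact Finset.analyticAt_fun_sum _ fun i _ => (hui i).mul analyticAt_const
    · exact Finset.analyticAt_fun_sum _ fun i _ => (hui i).mul (hvi i)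
  refine ⟨y 0, y, fun t => C t / C 0, ?_, fun t => (hT t).isPerronFrobeniusEigenvalue (hv t),
    fun t => (hva t).1, fun t => (hCa t).div analyticAt_const (hCpos 0).ne',
    fun t => div_pos (hCpos t) (hCpos 0), div_self (hCpos 0).ne', fun t => ?_⟩
  · rw [← R.tiltedMatrix_zero]
    exact (hT 0).isPerronFrobeniusEigenvalue (hv 0)
  obtain ⟨ρ, K, hρ, hρ1, hK⟩ :=
    (hT t).exists_abs_dotProduct_pow_mulVec_sub_le (hv t) (hu t) R.ξ R.η
  obtain ⟨σ, L, hσ, hσ1, hL⟩ :=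
    (hT 0).exists_abs_dotProduct_pow_mulVec_sub_le (hv 0) (hu 0) R.ξ R.η
  -- δ is taken to be the exact relative error, so the product formula is an identity and the
  -- O-bound carries the content.
  refine ⟨max ρ σ, lt_max_of_lt_left hρ, max_lt hρ1 hσ1, _,
    isBigO_div_div_sub_one (hy t) (hy 0) (hCpos t) (hCpos 0) hρ hρ1 hσ hσ1 hK hL, fun n _ => ?_⟩
  have h0 : C t / C 0 * (y t / y 0) ^ n ≠ 0 :=
    (mul_pos (div_pos (hCpos t) (hCpos 0)) (pow_pos (div_pos (hy t) (hy 0)) n)).ne'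
  rw [add_sub_cancel, mul_div_cancel₀ _ h0, R.momentGen_eq]
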